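/- Let $D$ be a metric space that is uniformly discrete (there is $\delta>0$ with $d(x,y)\ge\delta$ for all $x\ne y$ in $D$) and has bounded geometry (for every $R>0$ the number of points in balls of radius $R$ is uniformly bounded). For a Hilbert space $H$, let $C^*_H(D)\subset\mathbb B(\ell^2(D)\otimes H)$ be the Roe algebra, i.e. the norm closure of the $*$-algebra of operators $T$ that are locally compact ($Tf$ and $fT$ are compact for every $f\in C_0(D)$, acting by multiplication) and have finite propagation (there is $R>0$ with $fTg=0$ whenever the supports of $f,g\in C_0(D)$ are at distance greater than $R$); $C^*_{\mathbb C}(D)$ is the (unital) uniform Roe algebra. Let $V:\mathbb C\to H$ be an isometry, let $V_D=\mathrm{id}\otimes V:\ell^2(D)\to\ell^2(D)\otimes H$, and let $i_D:C^*_{\mathbb C}(D)\to C^*_H(D)$ be the $*$-homomorphism $i_D(T)=V_DTV_D^*$. For $\alpha>0$ let $D(\alpha)$ be the graph with vertex set $D$ in which two distinct points $x,y$ are joined by an edge whenever $d(x,y)\le\alpha$. Suppose that for every $\alpha>0$ the graph $D(\alpha)$ has at least one finite connected component. Then $(i_D)_*([1])\ne 0$ in $K_0(C^*_H(D))$, where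 $[1]\in K_0(C^*_{\mathbb C}(D))$ is the class of the unit. -/

import Mathlib

open scoped Matrix ENNReal ZeroAtInfty InnerProductSpace

noncomputable section

/-! ### `K₀` of C⋆-algebras, through projections in matrix algebras -/

section UnitalKTheory

variable {B C : Type*} [Ring B] [StarRing B] [Ring C] [StarRing C]

/-- Murray–von Neumann equivalence of (square, possibly of different size) matrices over `B`:
`p = v v⋆` and `q = v⋆ v` for some rectangular matrix `v`. -/
def MurrayVonNeumann {m n : Type*} [Fintype m] [Fintype n]
    (p : Matrix m m B) (q : Matrix n n B) : Prop :=
  ∃ v : Matrix m n B, v * vᴴ = p ∧ vᴴ * v = q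

namespace MurrayVonNeumann

variable {l m n m' n' : Type*} [Fintype l] [Fintype m] [Fintype n] [Fintype m'] [Fintype n']

theorem refl {p : Matrix m m B} (hp : IsStarProjection p) : MurrayVonNeumann p p := by
  have h1 : pᴴ = p := hp.isSelfAdjoint
  have h2 : p * p = p := hp.isIdempotentElem
  exact ⟨p, by rw [h1, h2], by rw [h1, h2]⟩

theorem symm {p : Matrix m m B} {q : Matrix n n B} (h : MurrayVonNeumann p q) :
    MurrayVonNeumann q p := by
  obtain ⟨v, h1, h2⟩ := h
  exact ⟨vᴴ, by simpa using h2, by simpa using h1⟩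

theorem trans {p : Matrix l l B} {q : Matrix m m B} {r : Matrix n n B}
    (hp : p * p = p) (hr : r * r = r)
    (h : MurrayVonNeumann p q) (h' : MurrayVonNeumann q r) : MurrayVonNeumann p r := by
  obtain ⟨v, hv1, hv2⟩ := h
  obtain ⟨w, hw1, hw2⟩ := h'
  refine ⟨v * w, ?_, ?_⟩
  · calc v * w * (v * w)ᴴ = v * (w * wᴴ) * vᴴ := by
          simp only [Matrix.conjTranspose_mul, Matrix.mul_assoc]
      _ = (v * vᴴ) * (v * vᴴ) := by rw [hw1, ← hv2]; simp only [Matrix.mul_assoc]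
      _ = p := by rw [hv1, hp]
  · calc (v * w)ᴴ * (v * w) = wᴴ * (vᴴ * v) * w := by
          simp only [Matrix.conjTranspose_mul, Matrix.mul_assoc]
      _ = (wᴴ * w) * (wᴴ * w) := by rw [hv2, ← hw1]; simp only [Matrix.mul_assoc]
      _ = r := by rw [hw2, hr]

theorem reindex {p : Matrix m m B} (hp : IsStarProjection p) (e : m ≃ n) :
    MurrayVonNeumann p (Matrix.reindex e e p) := by
  have h1 : pᴴ = p := hp.isSelfAdjoint
  have h2 : p * p = p := hp.isIdempotentElem
  refine ⟨p.submatrix id e.symm, ?_, ?_⟩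
  · rw [Matrix.conjTranspose_submatrix, h1, Matrix.submatrix_mul_equiv, h2, Matrix.submatrix_id_id]
  · rw [Matrix.conjTranspose_submatrix, h1, ← Matrix.submatrix_mul _ _ _ _ _ Function.bijective_id,
      h2, Matrix.reindex_apply]

theorem fromBlocks {p : Matrix m m B} {q : Matrix n n B} {p' : Matrix m' m' B}
    {q' : Matrix n' n' B} (h : MurrayVonNeumann p q) (h' : MurrayVonNeumann p' q') :
    MurrayVonNeumann (Matrix.fromBlocks p 0 0 p') (Matrix.fromBlocks q 0 0 q') := by
  obtain ⟨v, hv1, hv2⟩ := h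
  obtain ⟨w, hw1, hw2⟩ := h'
  refine ⟨Matrix.fromBlocks v 0 0 w, ?_, ?_⟩
  · simp [Matrix.fromBlocks_conjTranspose, Matrix.fromBlocks_multiply, hv1, hw1]
  · simp [Matrix.fromBlocks_conjTranspose, Matrix.fromBlocks_multiply, hv2, hw2]

end MurrayVonNeumann

theorem IsStarProjection.matrixFromBlocks {m n : Type*} [Fintype m] [Fintype n]
    {p : Matrix m m B} {q : Matrix n n B} (hp : IsStarProjection p) (hq : IsStarProjection q) :
    IsStarProjection (Matrix.fromBlocks p 0 0 q) := by
  have h1 : pᴴ = p := hp.isSelfAdjoint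
  have h2 : p * p = p := hp.isIdempotentElem
  have h3 : qᴴ = q := hq.isSelfAdjoint
  have h4 : q * q = q := hq.isIdempotentElem
  constructor
  · change _ * _ = _
    simp [Matrix.fromBlocks_multiply, h2, h4]
  · change (_)ᴴ = _
    simp [Matrix.fromBlocks_conjTranspose, h1, h3]

theorem IsStarProjection.matrixReindex {m n : Type*} [Fintype m] [Fintype n]
    {p : Matrix m m B} (hp : IsStarProjection p) (e : m ≃ n) :
    IsStarProjection (Matrix.reindex e e p) := by
  have h1 : pᴴ = p := hp.isSelfAdjoint
  have h2 : p * p = p := hp.isIdempotentElem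
  constructor
  · change _ * _ = _
    rw [Matrix.reindex_apply, Matrix.submatrix_mul_equiv, h2]
  · change (_)ᴴ = _
    rw [Matrix.reindex_apply, Matrix.conjTranspose_submatrix, h1]

variable (B) in
/-- A projection (self-adjoint idempotent) in some matrix algebra `Mₙ(B)`. -/
structure MatrixProjection where
  size : ℕ
  mat : Matrix (Fin size) (Fin size) B
  isStarProjection : IsStarProjection mat

namespace MatrixProjection

instance setoid : Setoid (MatrixProjection B) where
  r p q := MurrayVonNeumann p.mat q.mat
  iseqv :=
    { refl := fun p => .refl p.isStarProjection
      symm := fun h => h.symm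
      trans := fun {p _ r} h h' =>
        h.trans p.isStarProjection.isIdempotentElem r.isStarProjection.isIdempotentElem h' }

/-- The block sum `diag(p, q)`. -/
def add (p q : MatrixProjection B) : MatrixProjection B where
  size := p.size + q.size
  mat := Matrix.reindex finSumFinEquiv finSumFinEquiv (Matrix.fromBlocks p.mat 0 0 q.mat)
  isStarProjection := (p.isStarProjection.matrixFromBlocks q.isStarProjection).matrixReindex _

/-- The projection of size `0`. -/
def zero : MatrixProjection B where
  size := 0
  mat := 0
  isStarProjection := .zero _

/-- The image of a projection under a unital ⋆-homomorphism, applied entrywise. -/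
def map [Algebra ℂ B] [Algebra ℂ C] (φ : B →⋆ₐ[ℂ] C) (p : MatrixProjection B) :
    MatrixProjection C where
  size := p.size
  mat := p.mat.map φ
  isStarProjection := by
    have h1 : p.matᴴ = p.mat := p.isStarProjection.isSelfAdjoint
    have h2 : p.mat * p.mat = p.mat := p.isStarProjection.isIdempotentElem
    constructor
    · change _ * _ = _
      rw [← Matrix.map_mul, h2]
    · change (_)ᴴ = _
      rw [← Matrix.conjTranspose_map φ (fun x => map_star φ x), h1]

theorem add_equiv_fromBlocks (p q : MatrixProjection B) :
    MurrayVonNeumann (Matrix.fromBlocks p.mat 0 0 q.mat) (p.add q).mat :=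
  .reindex (p.isStarProjection.matrixFromBlocks q.isStarProjection) _

theorem add_equiv_of_fromBlocks {p q r : MatrixProjection B}
    (h : MurrayVonNeumann (Matrix.fromBlocks p.mat 0 0 q.mat) r.mat) : p.add q ≈ r :=
  MurrayVonNeumann.trans (p.add q).isStarProjection.isIdempotentElem
    r.isStarProjection.isIdempotentElem (add_equiv_fromBlocks p q).symm h

theorem add_congr {p p' q q' : MatrixProjection B} (h : p ≈ p') (h' : q ≈ q') :
    p.add q ≈ p'.add q' := by
  refine add_equiv_of_fromBlocks (MurrayVonNeumann.trans ?_ ?_ (MurrayVonNeumann.fromBlocks h h')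
    (add_equiv_fromBlocks p' q'))
  · exact (p.isStarProjection.matrixFromBlocks q.isStarProjection).isIdempotentElem
  · exact (p'.add q').isStarProjection.isIdempotentElem

theorem map_congr [Algebra ℂ B] [Algebra ℂ C] (φ : B →⋆ₐ[ℂ] C) {p q : MatrixProjection B}
    (h : p ≈ q) : p.map φ ≈ q.map φ := by
  obtain ⟨v, h1, h2⟩ := h
  have e1 : v.map φ * (v.map φ)ᴴ = p.mat.map φ := by
    rw [← Matrix.conjTranspose_map φ (fun x => map_star φ x), ← Matrix.map_mul, h1]
  have e2 : (v.map φ)ᴴ * v.map φ = q.mat.map φ := by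
    rw [← Matrix.conjTranspose_map φ (fun x => map_star φ x), ← Matrix.map_mul, h2]
  exact ⟨v.map φ, e1, e2⟩

theorem add_comm_equiv (p q : MatrixProjection B) : p.add q ≈ q.add p := by
  refine add_equiv_of_fromBlocks (MurrayVonNeumann.trans ?_ ?_ ?_ (add_equiv_fromBlocks q p))
  · exact (p.isStarProjection.matrixFromBlocks q.isStarProjection).isIdempotentElem
  · exact (q.add p).isStarProjection.isIdempotentElem
  · have := MurrayVonNeumann.reindex (p.isStarProjection.matrixFromBlocks q.isStarProjection)
      (Equiv.sumComm _ _)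
    simpa [Matrix.reindex_apply] using this

theorem zero_add_equiv (p : MatrixProjection B) : zero.add p ≈ p := by
  refine add_equiv_of_fromBlocks ?_
  have : MurrayVonNeumann (Matrix.fromBlocks (zero : MatrixProjection B).mat 0 0 p.mat)
      (Matrix.reindex (Equiv.emptySum (Fin 0) _) (Equiv.emptySum (Fin 0) _)
        (Matrix.fromBlocks (zero : MatrixProjection B).mat 0 0 p.mat)) :=
    MurrayVonNeumann.reindex
      ((zero : MatrixProjection B).isStarProjection.matrixFromBlocks p.isStarProjection) _
  have e : Matrix.reindex (Equiv.emptySum (Fin 0) _) (Equiv.emptySum (Fin 0) _)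
        (Matrix.fromBlocks (zero : MatrixProjection B).mat 0 0 p.mat) = p.mat := by
    ext i j; rfl
  rwa [e] at this

theorem add_assoc_equiv (p q r : MatrixProjection B) : (p.add q).add r ≈ p.add (q.add r) := by
  have hp := p.isStarProjection
  have hq := q.isStarProjection
  have hr := r.isStarProjection
  refine add_equiv_of_fromBlocks ?_
  have h1 : MurrayVonNeumann (Matrix.fromBlocks (p.add q).mat 0 0 r.mat)
      (Matrix.fromBlocks (Matrix.fromBlocks p.mat 0 0 q.mat) 0 0 r.mat) :=
    (add_equiv_fromBlocks p q).symm.fromBlocks (.refl hr)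
  have h2 : MurrayVonNeumann (Matrix.fromBlocks (Matrix.fromBlocks p.mat 0 0 q.mat) 0 0 r.mat)
      (Matrix.fromBlocks p.mat 0 0 (Matrix.fromBlocks q.mat 0 0 r.mat)) := by
    have := MurrayVonNeumann.reindex ((hp.matrixFromBlocks hq).matrixFromBlocks hr)
      (Equiv.sumAssoc _ _ _)
    convert this using 1
    ext (i | i | i) (j | j | j) <;> rfl
  have h3 : MurrayVonNeumann (Matrix.fromBlocks p.mat 0 0 (Matrix.fromBlocks q.mat 0 0 r.mat))
      (Matrix.fromBlocks p.mat 0 0 (q.add r).mat) :=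
    (MurrayVonNeumann.refl hp).fromBlocks (add_equiv_fromBlocks q r)
  have h4 := add_equiv_fromBlocks p (q.add r)
  have i1 := ((p.add q).isStarProjection.matrixFromBlocks hr).isIdempotentElem
  have i3 := (hp.matrixFromBlocks (hq.matrixFromBlocks hr)).isIdempotentElem
  have i4 := (hp.matrixFromBlocks (q.add r).isStarProjection).isIdempotentElem
  have i5 := (p.add (q.add r)).isStarProjection.isIdempotentElem
  exact ((h1.trans i1 i3 h2).trans i1 i4 h3).trans i1 i5 h4

theorem map_add_equiv [Algebra ℂ B] [Algebra ℂ C] (φ : B →⋆ₐ[ℂ] C) (p q : MatrixProjection B) :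
    (p.add q).map φ ≈ (p.map φ).add (q.map φ) := by
  have e : (p.add q).map φ = (p.map φ).add (q.map φ) := by
    simp only [add, map, MatrixProjection.mk.injEq, heq_eq_eq, true_and]
    simp only [Matrix.reindex_apply, ← Matrix.submatrix_map, Matrix.fromBlocks_map]
    rw [Matrix.map_zero _ (map_zero φ), Matrix.map_zero _ (map_zero φ)]
    rfl
  rw [e]

end MatrixProjection

variable (B) in
/-- The abelian semigroup `V(B)` of Murray–von Neumann classes of projections in matrices over
`B`, with block sum as addition. -/
def ProjectionClass : Type _ := Quotient (MatrixProjection.setoid (B := B))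

namespace ProjectionClass

instance : Add (ProjectionClass B) where
  add := Quotient.map₂ MatrixProjection.add
    (fun _ _ h _ _ h' => MatrixProjection.add_congr h h')

instance : Zero (ProjectionClass B) where
  zero := Quotient.mk _ MatrixProjection.zero

instance : AddCommMonoid (ProjectionClass B) where
  add_assoc := by
    rintro ⟨p⟩ ⟨q⟩ ⟨r⟩
    exact Quotient.sound (MatrixProjection.add_assoc_equiv p q r)
  zero_add := by
    rintro ⟨p⟩
    exact Quotient.sound (MatrixProjection.zero_add_equiv p)
  add_zero := by
    rintro ⟨p⟩
    exact Quotient.sound (Setoid.trans (MatrixProjection.add_comm_equiv p _)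
      (MatrixProjection.zero_add_equiv p))
  add_comm := by
    rintro ⟨p⟩ ⟨q⟩
    exact Quotient.sound (MatrixProjection.add_comm_equiv p q)
  nsmul := nsmulRec

/-- The class of a matrix projection. -/
def mk (p : MatrixProjection B) : ProjectionClass B := Quotient.mk _ p

/-- The additive map induced by a unital ⋆-homomorphism. -/
def map [Algebra ℂ B] [Algebra ℂ C] (φ : B →⋆ₐ[ℂ] C) :
    ProjectionClass B →+ ProjectionClass C where
  toFun := Quotient.map (MatrixProjection.map φ) (fun _ _ h => MatrixProjection.map_congr φ h)
  map_zero' := by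
    refine Quotient.sound ?_
    refine ⟨0, ?_, ?_⟩ <;> ext i <;> exact i.elim0
  map_add' := by
    rintro ⟨p⟩ ⟨q⟩
    exact Quotient.sound (MatrixProjection.map_add_equiv φ p q)

end ProjectionClass

variable (B) in
/-- `K₀` of a unital C⋆-algebra: the Grothendieck group of `V(B)`. -/
abbrev UnitalK0 : Type _ := Algebra.GrothendieckAddGroup (ProjectionClass B)

/-- The map on `K₀` induced by a unital ⋆-homomorphism. -/
def UnitalK0.map [Algebra ℂ B] [Algebra ℂ C] (φ : B →⋆ₐ[ℂ] C) : UnitalK0 B →+ UnitalK0 C :=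
  Algebra.GrothendieckAddGroup.lift
    (Algebra.GrothendieckAddGroup.of.comp (ProjectionClass.map φ))

end UnitalKTheory

section KTheory

variable {A A' : Type*}
  [NonUnitalRing A] [StarRing A] [Module ℂ A] [SMulCommClass ℂ A A] [IsScalarTower ℂ A A]
  [StarModule ℂ A]
  [NonUnitalRing A'] [StarRing A'] [Module ℂ A'] [SMulCommClass ℂ A' A'] [IsScalarTower ℂ A' A']
  [StarModule ℂ A']

variable (A) in
/-- The augmentation `A⁺ → ℂ`, `(z, a) ↦ z`, of the unitization. -/
def augmentation : Unitization ℂ A →⋆ₐ[ℂ] ℂ :=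
  Unitization.starLift (0 : A →⋆ₙₐ[ℂ] ℂ)

variable (A) in
/-- `K₀(A) = ker (K₀(A⁺) → K₀(ℂ))`, for a C⋆-algebra `A` that need not have a unit. -/
def K0 : AddSubgroup (UnitalK0 (Unitization ℂ A)) :=
  (UnitalK0.map (augmentation A)).ker

theorem UnitalK0.map_of {B C : Type*} [Ring B] [StarRing B] [Ring C] [StarRing C]
    [Algebra ℂ B] [Algebra ℂ C] (φ : B →⋆ₐ[ℂ] C) (x : ProjectionClass B) :
    UnitalK0.map φ (Algebra.GrothendieckAddGroup.of x) =
      Algebra.GrothendieckAddGroup.of (ProjectionClass.map φ x) :=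
  DFunLike.congr_fun (Algebra.GrothendieckAddGroup.lift.symm_apply_apply
    (Algebra.GrothendieckAddGroup.of.comp (ProjectionClass.map φ))) x

theorem UnitalK0.map_comp {B C E : Type*} [Ring B] [StarRing B] [Ring C] [StarRing C]
    [Ring E] [StarRing E] [Algebra ℂ B] [Algebra ℂ C] [Algebra ℂ E]
    (ψ : C →⋆ₐ[ℂ] E) (φ : B →⋆ₐ[ℂ] C) :
    (UnitalK0.map ψ).comp (UnitalK0.map φ) = UnitalK0.map (ψ.comp φ) := by
  apply Algebra.GrothendieckAddGroup.lift.symm.injective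
  ext x
  change UnitalK0.map ψ (UnitalK0.map φ (Algebra.GrothendieckAddGroup.of x)) =
    UnitalK0.map (ψ.comp φ) (Algebra.GrothendieckAddGroup.of x)
  rw [UnitalK0.map_of, UnitalK0.map_of, UnitalK0.map_of]
  obtain ⟨p⟩ := x
  rfl

@[simp]
theorem augmentation_inr (a : A) : augmentation A (a : Unitization ℂ A) = 0 :=
  Unitization.starLift_symm_apply_apply (augmentation A) a ▸
    DFunLike.congr_fun (Unitization.starLift.symm_apply_apply (0 : A →⋆ₙₐ[ℂ] ℂ)) a

theorem augmentation_comp_starMap (φ : A →⋆ₙₐ[ℂ] A') :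
    (augmentation A').comp (Unitization.starMap φ) = augmentation A := by
  apply Unitization.starAlgHom_ext
  ext a
  change augmentation A' (Unitization.starMap φ (a : Unitization ℂ A)) = augmentation A a
  rw [Unitization.starMap_inr, augmentation_inr, augmentation_inr]

/-- The homomorphism `φ_* : K₀(A) → K₀(A')` induced by a ⋆-homomorphism `φ : A → A'`. -/
def K0.map (φ : A →⋆ₙₐ[ℂ] A') : K0 A →+ K0 A' :=
  ((UnitalK0.map (Unitization.starMap φ)).comp (K0 A).subtype).codRestrict (K0 A') (by
    rintro ⟨x, hx⟩
    have h := DFunLike.congr_fun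
      (UnitalK0.map_comp (augmentation A') (Unitization.starMap φ)) x
    rw [augmentation_comp_starMap] at h
    exact h.trans hx)

/-- A projection `p ∈ A`, as a projection in the `1 × 1` matrices over `A⁺`. -/
def MatrixProjection.ofMem (p : A) (hp : IsStarProjection p) :
    MatrixProjection (Unitization ℂ A) where
  size := 1
  mat := Matrix.diagonal fun _ => (p : Unitization ℂ A)
  isStarProjection := by
    have h1 : star p = p := hp.isSelfAdjoint
    have h2 : p * p = p := hp.isIdempotentElem
    constructor
    · change _ * _ = _
      rw [Matrix.diagonal_mul_diagonal]
      simp only [← Unitization.inr_mul, h2]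
    · change (_)ᴴ = _
      rw [Matrix.diagonal_conjTranspose]
      congr 1
      ext1 i
      rw [Pi.star_apply, ← Unitization.inr_star, h1]

/-- The class `[p] ∈ K₀(A)` of a projection `p ∈ A`. -/
def K0.ofProjection (p : A) (hp : IsStarProjection p) : K0 A :=
  ⟨Algebra.GrothendieckAddGroup.of (ProjectionClass.mk (.ofMem p hp)), by
    change UnitalK0.map (augmentation A) _ = 0
    rw [UnitalK0.map_of]
    have : ProjectionClass.map (augmentation A) (ProjectionClass.mk (.ofMem p hp)) = 0 := by
      refine Quotient.sound ⟨0, ?_, ?_⟩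
      · have : (Matrix.diagonal fun _ : Fin 1 => (p : Unitization ℂ A)).map (augmentation A) =
            0 := by
          rw [Matrix.diagonal_map (map_zero _)]
          simp only [augmentation_inr, Matrix.diagonal_zero]
        exact (Matrix.zero_mul _).trans this.symm
      · ext i
        exact i.elim0
    rw [this, map_zero]⟩

end KTheory

/-! ### Locally compact and finite propagation operators -/

section Operators

variable {X E : Type*} [MetricSpace X] [NormedAddCommGroup E] [InnerProductSpace ℂ E]
  [CompleteSpace E]

/-- `T` is locally compact with respect to the action `ψ` of `C₀(X)` if `T ψ(f)` and `ψ(f) T` are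
compact operators for all `f ∈ C₀(X)`. -/
def IsLocallyCompactOperator (ψ : C₀(X, ℂ) →⋆ₙₐ[ℂ] (E →L[ℂ] E)) (T : E →L[ℂ] E) : Prop :=
  ∀ f : C₀(X, ℂ), IsCompactOperator (T * ψ f) ∧ IsCompactOperator (ψ f * T)

/-- `T` has finite propagation with respect to the action `ψ` of `C₀(X)` if there is `R > 0` with
`ψ(f) T ψ(g) = 0` whenever the supports of `f` and `g` are at distance greater than `R`.
(Requiring `R < dist x y` pointwise or for the infimum of the distances amounts to the same, after
enlarging `R`.) -/
def HasFinitePropagation (ψ : C₀(X, ℂ) →⋆ₙₐ[ℂ] (E →L[ℂ] E)) (T : E →L[ℂ] E) : Prop :=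
  ∃ R : ℝ, 0 < R ∧ ∀ f g : C₀(X, ℂ),
    (∀ x ∈ tsupport f, ∀ y ∈ tsupport g, R < dist x y) → ψ f * T * ψ g = 0

theorem isCompactOperator_star {T : E →L[ℂ] E} (hT : IsCompactOperator T) :
    IsCompactOperator (star T : E →L[ℂ] E) := by
  have hK : IsCompactOperator (T * star T : E →L[ℂ] E) := hT.comp_clm (star T : E →L[ℂ] E)
  have hK' := ((isCompactOperator_iff_isCompact_closure_image_closedBall
    (T * star T : E →L[ℂ] E).toLinearMap one_pos).1 hK).totallyBounded.subset subset_closure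
  refine (isCompactOperator_iff_isCompact_closure_image_closedBall
    (star T : E →L[ℂ] E).toLinearMap one_pos).2 ?_
  refine TotallyBounded.isCompact_of_isClosed (TotallyBounded.closure ?_) isClosed_closure
  rw [Metric.totallyBounded_iff]
  intro ε hε
  obtain ⟨u, hu, hufin, ht⟩ := Set.exists_subset_image_finite_and.1
    (Metric.finite_approx_of_totallyBounded hK' (ε ^ 2 / 2) (by positivity))
  refine ⟨(star T : E →L[ℂ] E) '' u, hufin.image _, ?_⟩
  rintro _ ⟨x, hx, rfl⟩
  obtain ⟨_, ⟨y, hy, rfl⟩, hxy⟩ := Set.mem_iUnion₂.1 (ht ⟨x, hx, rfl⟩)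
  refine Set.mem_iUnion₂.2 ⟨_, ⟨y, hy, rfl⟩, ?_⟩
  have hx1 : ‖x‖ ≤ 1 := by simpa using hx
  have hy1 : ‖y‖ ≤ 1 := by simpa using hu hy
  have hd : ‖(T * star T : E →L[ℂ] E) (x - y)‖ < ε ^ 2 / 2 := by
    rw [map_sub, ← dist_eq_norm]
    exact hxy
  have hd2 : ‖x - y‖ ≤ 2 := (norm_sub_le x y).trans (by linarith)
  have key : ‖(star T : E →L[ℂ] E) (x - y)‖ ^ 2 ≤
      ‖(T * star T : E →L[ℂ] E) (x - y)‖ * ‖x - y‖ := by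
    have h1 : inner ℂ ((star T : E →L[ℂ] E) (x - y)) ((star T : E →L[ℂ] E) (x - y)) =
        inner ℂ ((T * star T : E →L[ℂ] E) (x - y)) (x - y) := by
      conv_lhs => rw [ContinuousLinearMap.star_eq_adjoint, ContinuousLinearMap.adjoint_inner_right]
      rfl
    have h2 := norm_inner_le_norm (𝕜 := ℂ) ((T * star T : E →L[ℂ] E) (x - y)) (x - y)
    rw [← h1, inner_self_eq_norm_sq_to_K] at h2
    simpa using h2
  rw [Metric.mem_ball, dist_eq_norm]
  change ‖(star T : E →L[ℂ] E) x - (star T : E →L[ℂ] E) y‖ < ε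
  rw [← map_sub]
  refine lt_of_pow_lt_pow_left₀ 2 hε.le ?_
  have hn := norm_nonneg ((T * star T : E →L[ℂ] E) (x - y))
  nlinarith

variable {ψ : C₀(X, ℂ) →⋆ₙₐ[ℂ] (E →L[ℂ] E)} {S T : E →L[ℂ] E}

namespace IsLocallyCompactOperator

theorem zero : IsLocallyCompactOperator ψ 0 := fun f => by
  constructor
  · rw [zero_mul]; exact isCompactOperator_zero
  · rw [mul_zero]; exact isCompactOperator_zero

theorem add (hS : IsLocallyCompactOperator ψ S) (hT : IsLocallyCompactOperator ψ T) :
    IsLocallyCompactOperator ψ (S + T) := fun f => by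
  constructor
  · rw [add_mul]; exact (hS f).1.add (hT f).1
  · rw [mul_add]; exact (hS f).2.add (hT f).2

theorem smul (c : ℂ) (hT : IsLocallyCompactOperator ψ T) :
    IsLocallyCompactOperator ψ (c • T) := fun f => by
  constructor
  · rw [smul_mul_assoc]; exact (hT f).1.smul c
  · rw [mul_smul_comm]; exact (hT f).2.smul c

theorem mul (hS : IsLocallyCompactOperator ψ S) (hT : IsLocallyCompactOperator ψ T) :
    IsLocallyCompactOperator ψ (S * T) := fun f => by
  constructor
  · rw [mul_assoc]; exact (hT f).1.clm_comp S
  · rw [← mul_assoc]; exact (hS f).2.comp_clm T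

theorem star (hT : IsLocallyCompactOperator ψ T) : IsLocallyCompactOperator ψ (star T) := fun f => by
  constructor
  · have := isCompactOperator_star (hT (Star.star f)).2
    rwa [star_mul, map_star, star_star] at this
  · have := isCompactOperator_star (hT (Star.star f)).1
    rwa [star_mul, map_star, star_star] at this

end IsLocallyCompactOperator

namespace HasFinitePropagation

theorem zero : HasFinitePropagation ψ 0 :=
  ⟨1, one_pos, fun f g _ => by rw [mul_zero, zero_mul]⟩

theorem add (hS : HasFinitePropagation ψ S) (hT : HasFinitePropagation ψ T) :
    HasFinitePropagation ψ (S + T) := by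
  obtain ⟨R, hR, h⟩ := hS
  obtain ⟨R', hR', h'⟩ := hT
  refine ⟨max R R', lt_max_of_lt_left hR, fun f g hfg => ?_⟩
  rw [mul_add, add_mul, h f g (fun x hx y hy => (le_max_left _ _).trans_lt (hfg x hx y hy)),
    h' f g (fun x hx y hy => (le_max_right _ _).trans_lt (hfg x hx y hy)), add_zero]

theorem smul (c : ℂ) (hT : HasFinitePropagation ψ T) : HasFinitePropagation ψ (c • T) := by
  obtain ⟨R, hR, h⟩ := hT
  refine ⟨R, hR, fun f g hfg => ?_⟩
  rw [mul_smul_comm, smul_mul_assoc, h f g hfg, smul_zero]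

theorem star (hT : HasFinitePropagation ψ T) : HasFinitePropagation ψ (star T) := by
  obtain ⟨R, hR, h⟩ := hT
  have key : ∀ f : C₀(X, ℂ), tsupport (Star.star f : C₀(X, ℂ)) = tsupport f := fun f => by
    simp only [tsupport]
    congr 1
    ext x
    simp
  refine ⟨R, hR, fun f g hfg => ?_⟩
  have := h (Star.star g) (Star.star f) (fun x hx y hy => by
    rw [key] at hx hy
    rw [dist_comm]
    exact hfg y hy x hx)
  have := congrArg (Star.star : (E →L[ℂ] E) → (E →L[ℂ] E)) this
  rwa [star_mul, star_mul, map_star, map_star, star_star, star_star, star_zero, ← mul_assoc] at this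

end HasFinitePropagation

end Operators

/-! ### The Roe algebras of a discrete metric space -/

section Roe

/-- `L²(D) ⊗ H = ℓ²(D, H)`, for the counting measure on `D`. -/
abbrev EllTwo (D H : Type*) [NormedAddCommGroup H] : Type _ := lp (fun _ : D => H) 2

variable {D : Type*} {H : Type*} [NormedAddCommGroup H] [InnerProductSpace ℂ H]

variable (D) in
/-- The isometry `V_D = id ⊗ V : ℓ²(D) → ℓ²(D) ⊗ H` given by an isometry `V : ℂ → H`, that is,
`V` applied pointwise. -/
def isometryTensor (V : ℂ →ₗᵢ[ℂ] H) : EllTwo D ℂ →L[ℂ] EllTwo D H :=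
  lp.mapCLM 2 (fun _ => V.toContinuousLinearMap) zero_le_one
    (fun _ => V.norm_toContinuousLinearMap_le)

@[simp]
theorem isometryTensor_apply (V : ℂ →ₗᵢ[ℂ] H) (ξ : EllTwo D ℂ) (x : D) :
    isometryTensor D V ξ x = V (ξ x) := rfl

theorem adjoint_isometryTensor_comp [CompleteSpace H] (V : ℂ →ₗᵢ[ℂ] H) :
    (isometryTensor D V).adjoint ∘L isometryTensor D V = 1 := by
  ext1 ξ
  refine ext_inner_left ℂ fun η => ?_
  rw [ContinuousLinearMap.comp_apply, ContinuousLinearMap.adjoint_inner_right, lp.inner_eq_tsum,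
    one_apply_eq_self, lp.inner_eq_tsum]
  simp only [isometryTensor_apply, LinearIsometry.inner_map_map]

variable (D) in
/-- Conjugation `T ↦ V_D T V_D⋆` on all bounded operators. -/
def conjugation [CompleteSpace H] (V : ℂ →ₗᵢ[ℂ] H) :
    (EllTwo D ℂ →L[ℂ] EllTwo D ℂ) →⋆ₙₐ[ℂ] (EllTwo D H →L[ℂ] EllTwo D H) where
  toFun T := isometryTensor D V ∘L T ∘L (isometryTensor D V).adjoint
  map_smul' c T := by ext; simp
  map_zero' := by ext; simp
  map_add' S T := by ext; simp
  map_mul' S T := by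
    ext1 ξ
    exact congrArg (fun η => isometryTensor D V (S η))
      (DFunLike.congr_fun (adjoint_isometryTensor_comp V)
        (T ((isometryTensor D V).adjoint ξ))).symm
  map_star' T := by
    rw [ContinuousLinearMap.star_eq_adjoint, ContinuousLinearMap.star_eq_adjoint,
      ContinuousLinearMap.adjoint_comp, ContinuousLinearMap.adjoint_comp,
      ContinuousLinearMap.adjoint_adjoint]
    rfl

theorem conjugation_apply [CompleteSpace H] (V : ℂ →ₗᵢ[ℂ] H) (T : EllTwo D ℂ →L[ℂ] EllTwo D ℂ) :
    conjugation D V T = isometryTensor D V ∘L T ∘L (isometryTensor D V).adjoint := rfl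

theorem continuous_conjugation [CompleteSpace H] (V : ℂ →ₗᵢ[ℂ] H) : Continuous (conjugation D V) := by
  change Continuous fun T : EllTwo D ℂ →L[ℂ] EllTwo D ℂ =>
    isometryTensor D V ∘L T ∘L (isometryTensor D V).adjoint
  fun_prop

section Topology

variable [TopologicalSpace D]

/-- Multiplication by `f ∈ C₀(D)` on `ℓ²(D, H)`. -/
def multiplication (f : C₀(D, ℂ)) : EllTwo D H →L[ℂ] EllTwo D H :=
  lp.mapCLM 2 (fun x => f x • ContinuousLinearMap.id ℂ H) (norm_nonneg f) (fun x => by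
    refine ContinuousLinearMap.opNorm_le_bound _ (norm_nonneg f) (fun ξ => ?_)
    simp only [_root_.smul_apply, ContinuousLinearMap.id_apply, norm_smul]
    gcongr
    rw [← ZeroAtInftyContinuousMap.norm_toBCF_eq_norm]
    exact f.toBCF.norm_coe_le_norm x)

theorem norm_multiplication_le (f : C₀(D, ℂ)) :
    ‖(multiplication f : EllTwo D H →L[ℂ] EllTwo D H)‖ ≤ ‖f‖ := by
  unfold multiplication
  exact lp.norm_mapCLM_le _ _ _ _

@[simp]
theorem multiplication_apply (f : C₀(D, ℂ)) (ξ : EllTwo D H) (x : D) :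
    multiplication f ξ x = f x • ξ x := rfl

variable (D H) in
/-- The standard action of `C₀(D)` on `ℓ²(D, H)` by multiplication. -/
def multiplicationRep [CompleteSpace H] :
    C₀(D, ℂ) →⋆ₙₐ[ℂ] (EllTwo D H →L[ℂ] EllTwo D H) where
  toFun := multiplication
  map_smul' c f := by ext ξ x; simp [mul_smul]
  map_zero' := by ext ξ x; simp
  map_add' f g := by ext ξ x; simp [add_smul]
  map_mul' f g := by ext ξ x; simp [mul_smul]
  map_star' f := by
    rw [ContinuousLinearMap.star_eq_adjoint, ContinuousLinearMap.eq_adjoint_iff]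
    intro ξ η
    rw [lp.inner_eq_tsum, lp.inner_eq_tsum]
    congr 1
    ext x
    simp [inner_smul_left, inner_smul_right]

@[simp]
theorem multiplicationRep_apply [CompleteSpace H] (f : C₀(D, ℂ)) (ξ : EllTwo D H) (x : D) :
    multiplicationRep D H f ξ x = f x • ξ x := rfl

theorem multiplicationRep_comp_isometryTensor [CompleteSpace H] (V : ℂ →ₗᵢ[ℂ] H) (f : C₀(D, ℂ)) :
    multiplicationRep D H f ∘L isometryTensor D V =
      isometryTensor D V ∘L multiplicationRep D ℂ f := by
  ext ξ x
  exact (V.map_smul (f x) (ξ x)).symm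

theorem adjoint_isometryTensor_comp_multiplicationRep [CompleteSpace H] (V : ℂ →ₗᵢ[ℂ] H) (f : C₀(D, ℂ)) :
    (isometryTensor D V).adjoint ∘L multiplicationRep D H f =
      multiplicationRep D ℂ f ∘L (isometryTensor D V).adjoint := by
  have h := congrArg ContinuousLinearMap.adjoint
    (multiplicationRep_comp_isometryTensor V (star f))
  rw [ContinuousLinearMap.adjoint_comp, ContinuousLinearMap.adjoint_comp,
    ← ContinuousLinearMap.star_eq_adjoint, ← ContinuousLinearMap.star_eq_adjoint,
    ← map_star, ← map_star, star_star] at h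
  exact h

/-- The indicator function of a point of a discrete space. -/
def pointIndicator [DiscreteTopology D] (z : D) : C₀(D, ℂ) where
  toFun := Set.indicator {z} 1
  continuous_toFun := continuous_of_discreteTopology
  zero_at_infty' := by
    refine tendsto_const_nhds.congr' ?_
    filter_upwards [(isCompact_singleton (x := z)).compl_mem_cocompact] with x hx
    exact (Set.indicator_of_notMem hx _).symm

end Topology

variable [MetricSpace D] [DiscreteTopology D] [CompleteSpace H]

theorem HasFinitePropagation.mul {S T : EllTwo D H →L[ℂ] EllTwo D H}
    (hS : HasFinitePropagation (multiplicationRep D H) S)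
    (hT : HasFinitePropagation (multiplicationRep D H) T) :
    HasFinitePropagation (multiplicationRep D H) (S * T) := by
  classical
  obtain ⟨R, hR, h⟩ := hS
  obtain ⟨R', hR', h'⟩ := hT
  refine ⟨R + R', add_pos hR hR', fun f g hfg => ?_⟩
  have hsupp : ∀ z y : D, y ∈ tsupport (pointIndicator z) → y = z := fun z y hy => by
    rw [tsupport, closure_discrete] at hy
    by_contra hne
    exact hy (Set.indicator_of_notMem (s := {z}) hne 1)
  have hself : ∀ z : D, pointIndicator z z = 1 := fun z =>
    Set.indicator_of_mem (s := {z}) rfl 1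
  ext1 ξ
  set η : EllTwo D H := T (multiplicationRep D H g ξ) with hη
  change (multiplicationRep D H f) (S η) = 0
  have hsum := lp.hasSum_single (p := 2) (by simp) η
  have hsum' := ((multiplicationRep D H f).comp S).hasSum hsum
  have hzero : ∀ z : D, ((multiplicationRep D H f).comp S) (lp.single 2 z (η z)) = 0 := by
    intro z
    by_cases hz : ∃ y ∈ tsupport g, dist z y ≤ R'
    · obtain ⟨y, hy, hzy⟩ := hz
      have hfz := h f (pointIndicator z) (fun x hx w hw => by
        rw [hsupp z w hw]
        have h1 := hfg x hx y hy
        have h2 := dist_triangle x z y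
        linarith)
      have hsingle : multiplicationRep D H (pointIndicator z) (lp.single 2 z (η z)) =
          lp.single 2 z (η z) := by
        ext x
        rw [multiplicationRep_apply]
        by_cases hx : x = z
        · subst hx
          rw [hself, one_smul]
        · rw [lp.single_apply_ne _ _ _ hx, smul_zero]
      have := DFunLike.congr_fun hfz (lp.single 2 z (η z))
      change multiplicationRep D H f (S (multiplicationRep D H (pointIndicator z) _)) = 0 at this
      rw [hsingle] at this
      exact this
    · push Not at hz
      have hzg := h' (pointIndicator z) g (fun x hx y hy => by
        rw [hsupp z x hx]
        exact hz y hy)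
      have hηz : η z = 0 := by
        have := DFunLike.congr_fun hzg ξ
        change multiplicationRep D H (pointIndicator z) η = 0 at this
        have := congrArg (fun ζ : EllTwo D H => ζ z) this
        simpa [hself] using this
      rw [hηz, lp.single_zero, map_zero]
  simp only [hzero] at hsum'
  exact hsum'.unique hasSum_zero

variable (D H) in
/-- The ⋆-algebra of locally compact operators of finite propagation on `ℓ²(D, H)`. -/
def algebraicRoeAlgebra : NonUnitalStarSubalgebra ℂ (EllTwo D H →L[ℂ] EllTwo D H) where
  carrier := {T | IsLocallyCompactOperator (multiplicationRep D H) T ∧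
    HasFinitePropagation (multiplicationRep D H) T}
  zero_mem' := ⟨.zero, .zero⟩
  add_mem' hS hT := ⟨hS.1.add hT.1, hS.2.add hT.2⟩
  mul_mem' hS hT := ⟨hS.1.mul hT.1, hS.2.mul hT.2⟩
  smul_mem' c _ hT := ⟨hT.1.smul c, hT.2.smul c⟩
  star_mem' hT := ⟨hT.1.star, hT.2.star⟩

variable (D H) in
/-- The Roe algebra `C⋆_H(D)`: the norm closure of the ⋆-algebra of locally compact operators of
finite propagation. For `H = ℂ` this is the uniform Roe algebra `C⋆_ℂ(D)`. -/
def RoeAlgebra : NonUnitalStarSubalgebra ℂ (EllTwo D H →L[ℂ] EllTwo D H) :=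
  (algebraicRoeAlgebra D H).topologicalClosure

theorem isCompactOperator_multiplicationRep (f : C₀(D, ℂ)) :
    IsCompactOperator (multiplicationRep D ℂ f) := by
  classical
  have hself : ∀ z : D, pointIndicator z z = 1 := fun z =>
    Set.indicator_of_mem (s := {z}) rfl 1
  have hne : ∀ z x : D, x ≠ z → pointIndicator z x = 0 := fun z x hx =>
    Set.indicator_of_notMem (s := {z}) hx 1
  have hpoint : ∀ z : D, IsCompactOperator (multiplicationRep D ℂ (pointIndicator z)) := by
    intro z
    let ev : EllTwo D ℂ →L[ℂ] ℂ := innerSL ℂ (lp.single 2 z (1 : ℂ) : EllTwo D ℂ)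
    have hev : IsCompactOperator ev := isCompactOperator_of_locallyCompactSpace_dom ev
    have hcomp := hev.clm_comp (lp.singleContinuousLinearMap ℂ (fun _ : D => ℂ) 2 z)
    have heq : ⇑(multiplicationRep D ℂ (pointIndicator z)) =
        ⇑(lp.singleContinuousLinearMap ℂ (fun _ : D => ℂ) 2 z) ∘ ⇑ev := by
      funext ξ
      refine lp.ext (funext fun x => ?_)
      have hz : ev ξ = ξ z := by
        simp [ev, lp.inner_single_left]
      rw [multiplicationRep_apply, Function.comp_apply, hz, lp.singleContinuousLinearMap_apply]
      by_cases hx : x = z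
      · subst hx
        rw [hself, one_smul, lp.single_apply_self]
      · rw [hne z x hx, zero_smul, lp.single_apply_ne _ _ _ hx]
    rw [heq]
    exact hcomp
  let K := {T : EllTwo D ℂ →L[ℂ] EllTwo D ℂ | IsCompactOperator T}
  have hclosed : IsClosed K := isClosed_setOfPred_isCompactOperator
  have hcont : Continuous (multiplicationRep D ℂ) :=
    AddMonoidHomClass.continuous_of_bound _ 1 (fun g => by
      rw [one_mul]
      exact norm_multiplication_le g)
  have hC : IsClosed (multiplicationRep D ℂ ⁻¹' K) := hclosed.preimage hcont
  change f ∈ multiplicationRep D ℂ ⁻¹' K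
  rw [← hC.closure_eq, Metric.mem_closure_iff]
  intro ε hε
  have hfin : {x : D | ε / 2 ≤ ‖f x‖}.Finite := by
    have h0 := (zero_at_infty f).norm
    rw [norm_zero] at h0
    have h1 := h0.eventually (gt_mem_nhds (half_pos hε))
    rw [Filter.cocompact_eq_cofinite, Filter.eventually_cofinite] at h1
    simpa using h1
  let g : C₀(D, ℂ) := ∑ z ∈ hfin.toFinset, f z • pointIndicator z
  have hgx : ∀ x, g x = if ε / 2 ≤ ‖f x‖ then f x else 0 := by
    intro x
    have h1 : g x = ∑ z ∈ hfin.toFinset, f z * pointIndicator z x := by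
      have := map_sum (⟨⟨fun h : C₀(D, ℂ) => h x, rfl⟩, fun _ _ => rfl⟩ : C₀(D, ℂ) →+ ℂ)
        (fun z => f z • pointIndicator z) hfin.toFinset
      exact this
    rw [h1]
    split_ifs with h
    · rw [Finset.sum_eq_single x (fun z _ hz => by rw [hne z x hz.symm, mul_zero])
        (fun hx => absurd (hfin.mem_toFinset.2 h) hx), hself, mul_one]
    · refine Finset.sum_eq_zero fun z hz => ?_
      have hzx : x ≠ z := fun e => h (e ▸ hfin.mem_toFinset.1 hz)
      rw [hne z x hzx, mul_zero]
  refine ⟨g, ?_, ?_⟩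
  · change IsCompactOperator (multiplicationRep D ℂ g)
    change multiplicationRep D ℂ g ∈ compactOperator (RingHom.id ℂ) (EllTwo D ℂ) (EllTwo D ℂ)
    rw [map_sum]
    refine Submodule.sum_mem _ fun z _ => ?_
    rw [map_smul]
    exact Submodule.smul_mem _ _ (hpoint z)
  · rw [dist_eq_norm, ← ZeroAtInftyContinuousMap.norm_toBCF_eq_norm]
    refine lt_of_le_of_lt ((BoundedContinuousFunction.norm_le (half_pos hε).le).2 fun x => ?_)
      (half_lt_self hε)
    change ‖f x - g x‖ ≤ ε / 2
    rw [hgx]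
    split_ifs with h
    · rw [sub_self, norm_zero]
      exact (half_pos hε).le
    · rw [sub_zero]
      exact (not_le.1 h).le

variable (D) in
theorem one_mem_uniformRoeAlgebra : (1 : EllTwo D ℂ →L[ℂ] EllTwo D ℂ) ∈ RoeAlgebra D ℂ := by
  refine NonUnitalStarSubalgebra.le_topologicalClosure _ ⟨fun f => ?_, 1, one_pos, fun f g hfg => ?_⟩
  · rw [one_mul, mul_one]
    exact ⟨isCompactOperator_multiplicationRep f, isCompactOperator_multiplicationRep f⟩
  · rw [mul_one]
    ext ξ x
    change f x • g x • ξ x = 0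
    by_cases hf : f x = 0
    · rw [hf, zero_smul]
    by_cases hg : g x = 0
    · rw [hg, zero_smul, smul_zero]
    have := hfg x (subset_tsupport _ hf) x (subset_tsupport _ hg)
    rw [dist_self] at this
    linarith

variable (D) in
/-- The unit of the uniform Roe algebra. -/
def uniformRoeUnit : RoeAlgebra D ℂ := ⟨1, one_mem_uniformRoeAlgebra D⟩

variable (D) in
theorem isStarProjection_uniformRoeUnit : IsStarProjection (uniformRoeUnit D) :=
  ⟨Subtype.ext (one_mul 1), Subtype.ext (star_one _)⟩

theorem conjugation_mem (V : ℂ →ₗᵢ[ℂ] H) {T : EllTwo D ℂ →L[ℂ] EllTwo D ℂ}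
    (hT : T ∈ RoeAlgebra D ℂ) : conjugation D V T ∈ RoeAlgebra D H := by
  refine map_mem_closure (continuous_conjugation V) hT ?_
  rintro T ⟨hc, R, hR, h⟩
  have hr : ∀ f : C₀(D, ℂ), conjugation D V T * multiplicationRep D H f =
      isometryTensor D V ∘L (T * multiplicationRep D ℂ f) ∘L (isometryTensor D V).adjoint := by
    intro f
    ext1 ξ
    exact congrArg (fun η => isometryTensor D V (T η))
      (DFunLike.congr_fun (adjoint_isometryTensor_comp_multiplicationRep V f) ξ)
  have hl : ∀ S : EllTwo D ℂ →L[ℂ] EllTwo D ℂ, ∀ f : C₀(D, ℂ),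
      multiplicationRep D H f * (isometryTensor D V ∘L S ∘L (isometryTensor D V).adjoint) =
      isometryTensor D V ∘L (multiplicationRep D ℂ f * S) ∘L (isometryTensor D V).adjoint := by
    intro S f
    ext1 ξ
    exact DFunLike.congr_fun (multiplicationRep_comp_isometryTensor V f)
      (S ((isometryTensor D V).adjoint ξ))
  refine ⟨fun f => ⟨?_, ?_⟩, R, hR, fun f g hfg => ?_⟩
  · rw [hr]
    exact ((hc f).1.comp_clm (isometryTensor D V).adjoint).clm_comp (isometryTensor D V)
  · rw [conjugation_apply, hl]
    exact ((hc f).2.comp_clm (isometryTensor D V).adjoint).clm_comp (isometryTensor D V)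
  · rw [mul_assoc, hr, hl, ← mul_assoc, h f g hfg]
    ext1 ξ
    exact map_zero (isometryTensor D V)

/-- The ⋆-homomorphism `i_D : C⋆_ℂ(D) → C⋆_H(D)`, `T ↦ V_D T V_D⋆`. -/
def roeInclusion (D : Type*) [MetricSpace D] [DiscreteTopology D] (V : ℂ →ₗᵢ[ℂ] H) :
    RoeAlgebra D ℂ →⋆ₙₐ[ℂ] RoeAlgebra D H :=
  NonUnitalStarAlgHom.codRestrict
    ((conjugation D V).comp (NonUnitalStarSubalgebraClass.subtype (RoeAlgebra D ℂ)))
    (RoeAlgebra D H) (fun T => conjugation_mem V T.2)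

end Roe

/-! ### Coarse geometry -/

/-- A metric space is uniformly discrete if distinct points have distance bounded below by a
positive constant. -/
class UniformlyDiscrete (D : Type*) [MetricSpace D] : Prop where
  exists_le_dist : ∃ δ : ℝ, 0 < δ ∧ ∀ x y : D, x ≠ y → δ ≤ dist x y

instance UniformlyDiscrete.discreteTopology (D : Type*) [MetricSpace D] [UniformlyDiscrete D] :
    DiscreteTopology D := by
  obtain ⟨δ, hδ, h⟩ := UniformlyDiscrete.exists_le_dist (D := D)
  exact DiscreteTopology.of_forall_le_dist hδ (fun x y hxy => h x y hxy)

/-- A discrete metric space has bounded geometry if, for each `R > 0`, the number of points in balls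
of radius `R` is uniformly bounded. -/
def BoundedGeometry (D : Type*) [MetricSpace D] : Prop :=
  ∀ R : ℝ, 0 < R → ∃ N : ℕ, ∀ x : D, (Metric.closedBall x R).encard ≤ N

/-- The graph `D(α)`: its vertices are the points of `D`, and two (distinct) points `x`, `y` are
joined by an edge whenever `d(x, y) ≤ α`. -/
def distanceGraph (D : Type*) [MetricSpace D] (α : ℝ) : SimpleGraph D where
  Adj x y := x ≠ y ∧ dist x y ≤ α
  symm := ⟨fun x y h => ⟨h.1.symm, by rw [dist_comm]; exact h.2⟩⟩
  loopless := ⟨fun x h => h.1 rfl⟩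

end

/-!
The projection `Q_α` onto the functions supported in a finite component of `D(α)` commutes with
every operator of propagation at most `α`. As `α` grows, the `Q_α` thus asymptotically commute with
the Roe algebra, and `Q_α T` is compact for each `T` in it.

If the class of a projection `p` vanishes, then `p ⊕ r ∼ r` for some projection `r` over the
unitization, so that there are matrices `W`, `S` with `W S = 1` such that `W` kills a copy of `p`,
and `S` may be taken to have scalar part `1`. The compression of `S` to the range of `Q_α` is a
compact perturbation of the identity and almost left invertible, hence invertible by the Fredholm
alternative; its inverse is then close to the compression of `W`, which almost kills the compression
of the copy of `p`. This forces `p Q_α → 0`. For `p = V_D V_D⋆` this is absurd, because `p` fixes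
the unit vector `δ_z ⊗ V 1` at any point `z` of the component.
-/

noncomputable section

open Filter Topology
open scoped Ring

section StableEquivalence

variable {B : Type*} [Ring B] [StarRing B]

theorem MatrixProjection.exists_fromBlocks_equiv_of_class_eq_zero (p : MatrixProjection B)
    (h : Algebra.GrothendieckAddGroup.of (ProjectionClass.mk p) = 0) :
    ∃ r : MatrixProjection B, MurrayVonNeumann (Matrix.fromBlocks p.mat 0 0 r.mat) r.mat := by
  rw [← map_zero Algebra.GrothendieckAddGroup.of] at h
  obtain ⟨⟨⟨r⟩, _⟩, hr⟩ :=
    ((AddLocalization.addMonoidOf (⊤ : AddSubmonoid (ProjectionClass B))).eq_iff_exists).1 h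
  have hclass : ProjectionClass.mk r + ProjectionClass.mk p = ProjectionClass.mk r + 0 := hr
  rw [add_zero, add_comm] at hclass
  have hpr : p.add r ≈ r := Quotient.exact hclass
  exact ⟨r, (MatrixProjection.add_equiv_fromBlocks p r).trans
    (p.isStarProjection.matrixFromBlocks r.isStarProjection).isIdempotentElem
    r.isStarProjection.isIdempotentElem hpr⟩

namespace MurrayVonNeumann

variable {m n : Type*} [Fintype m] [Fintype n]

theorem exists_partialIsometry {p : Matrix m m B} {q : Matrix n n B} (hp : IsIdempotentElem p)
    (hq : IsStarProjection q) (h : MurrayVonNeumann p q) :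
    ∃ u : Matrix m n B, u * uᴴ = p ∧ uᴴ * u = q ∧ u * q = u := by
  obtain ⟨v, hvv, hvv'⟩ := h
  have hqq : q * q = q := hq.isIdempotentElem
  have hqs : qᴴ = q := hq.isSelfAdjoint
  refine ⟨v * q, ?_, ?_, ?_⟩
  · calc v * q * (v * q)ᴴ = v * (q * q) * vᴴ := by
          simp only [Matrix.conjTranspose_mul, hqs, Matrix.mul_assoc]
      _ = v * vᴴ * (v * vᴴ) := by rw [hqq, ← hvv']; simp only [Matrix.mul_assoc]
      _ = p := by rw [hvv, hp]
  · calc (v * q)ᴴ * (v * q) = q * (vᴴ * v) * q := by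
          simp only [Matrix.conjTranspose_mul, hqs, Matrix.mul_assoc]
      _ = q := by rw [hvv', hqq, hqq]
  · rw [Matrix.mul_assoc, hqq]

theorem exists_right_inverse [DecidableEq n] {p : Matrix m m B} {r : Matrix n n B}
    (hp : IsStarProjection p) (hr : IsStarProjection r)
    (h : MurrayVonNeumann (Matrix.fromBlocks p 0 0 r) r) :
    ∃ (W S : Matrix n n B) (a : Matrix m n B) (t : Matrix n m B),
      W * S = 1 ∧ W * t = 0 ∧ a * t = p := by
  obtain ⟨u, huu, -, hur⟩ :=
    h.exists_partialIsometry (hp.matrixFromBlocks hr).isIdempotentElem hr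
  obtain ⟨a, b, rfl⟩ : ∃ a b, u = Matrix.fromRows a b := ⟨_, _, (Matrix.fromRows_toRows u).symm⟩
  rw [Matrix.conjTranspose_fromRows_eq_fromCols_conjTranspose, Matrix.fromRows_mul_fromCols,
    Matrix.fromBlocks_inj] at huu
  rw [Matrix.fromRows_mul, Matrix.fromRows_inj.eq_iff] at hur
  obtain ⟨haa, -, hba, hbb⟩ := huu
  obtain ⟨har, hbr⟩ := hur
  have hrs : rᴴ = r := hr.isSelfAdjoint
  have hra : r * aᴴ = aᴴ := by rw [← hrs, ← Matrix.conjTranspose_mul, har]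
  have hrb : r * bᴴ = bᴴ := by rw [← hrs, ← Matrix.conjTranspose_mul, hbr]
  have hrr : (1 - r) * (1 - r) = 1 - r := hr.isIdempotentElem.one_sub
  -- `b` is a partial isometry inside the corner of `r` with `b * bᴴ = r` that kills `aᴴ`; adding
  -- `1 - r` completes it to a co-isometry.
  refine ⟨b + (1 - r), bᴴ + (1 - r), a, aᴴ, ?_, ?_, haa⟩
  · calc (b + (1 - r)) * (bᴴ + (1 - r))
        = b * bᴴ + (b - b * r) + (bᴴ - r * bᴴ) + (1 - r) * (1 - r) := by noncomm_ring
      _ = 1 := by rw [hbb, hbr, hrb, hrr]; abel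
  · rw [Matrix.add_mul, hba, Matrix.sub_mul, Matrix.one_mul, hra, sub_self, add_zero]

end MurrayVonNeumann

end StableEquivalence

section ScalarPart

variable {A : Type*} [NonUnitalRing A] [Module ℂ A] [SMulCommClass ℂ A A] [IsScalarTower ℂ A A]
  {m n : Type*} [Fintype n] [DecidableEq n]

theorem exists_right_inverse_scalarPart_eq_one {W S : Matrix n n (Unitization ℂ A)}
    {t : Matrix n m (Unitization ℂ A)} (hWS : W * S = 1) (hWt : W * t = 0) :
    ∃ W' S' : Matrix n n (Unitization ℂ A),
      W' * S' = 1 ∧ W' * t = 0 ∧ S'.map (Unitization.fstHom ℂ A) = 1 := by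
  let φ := (Unitization.fstHom ℂ A).mapMatrix (m := n)
  let ι := (Algebra.ofId ℂ (Unitization ℂ A)).mapMatrix (m := n)
  have hφι : ∀ M, φ (ι M) = M := fun M => Matrix.ext fun _ _ => rfl
  have hφ : φ S * φ W = 1 := mul_eq_one_comm.1 (by rw [← map_mul, hWS, map_one])
  refine ⟨ι (φ S) * W, S * ι (φ W), ?_, ?_, ?_⟩
  · rw [mul_assoc, ← mul_assoc W, hWS, one_mul, ← map_mul, hφ, map_one]
  · rw [Matrix.mul_assoc, hWt, Matrix.mul_zero]
  · calc φ (S * ι (φ W)) = φ S * φ W := by rw [map_mul, hφι]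
      _ = 1 := hφ

end ScalarPart

section VanishingClass

variable {A A' : Type*}
  [NonUnitalRing A] [StarRing A] [Module ℂ A] [SMulCommClass ℂ A A] [IsScalarTower ℂ A A]
  [StarModule ℂ A]
  [NonUnitalRing A'] [StarRing A'] [Module ℂ A'] [SMulCommClass ℂ A' A'] [IsScalarTower ℂ A' A']
  [StarModule ℂ A']

theorem K0.map_ofProjection (φ : A →⋆ₙₐ[ℂ] A') (p : A) (hp : IsStarProjection p) :
    K0.map φ (K0.ofProjection p hp) = K0.ofProjection (φ p) (hp.map φ) := by
  have hmat : ((MatrixProjection.ofMem p hp).map (Unitization.starMap φ)).mat =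
      (MatrixProjection.ofMem (φ p) (hp.map φ)).mat := by
    change (Matrix.diagonal fun _ : Fin 1 => (p : Unitization ℂ A)).map _ = Matrix.diagonal _
    simp only [Matrix.diagonal_map (map_zero _), Unitization.starMap_inr]
  apply Subtype.ext
  change UnitalK0.map _ (Algebra.GrothendieckAddGroup.of _) = Algebra.GrothendieckAddGroup.of _
  rw [UnitalK0.map_of]
  congr 1
  refine Quotient.sound ?_
  change MurrayVonNeumann _ _
  rw [hmat]
  exact .refl (MatrixProjection.ofMem (φ p) (hp.map φ)).isStarProjection

theorem K0.exists_right_inverse_of_ofProjection_eq_zero {p : A} {hp : IsStarProjection p}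
    (h : K0.ofProjection p hp = 0) :
    ∃ (n : ℕ) (W S : Matrix (Fin n) (Fin n) (Unitization ℂ A))
      (a : Matrix (Fin 1) (Fin n) (Unitization ℂ A))
      (t : Matrix (Fin n) (Fin 1) (Unitization ℂ A)),
      W * S = 1 ∧ W * t = 0 ∧ a * t = Matrix.diagonal (fun _ => (p : Unitization ℂ A)) ∧
        S.map (Unitization.fstHom ℂ A) = 1 := by
  obtain ⟨r, hr⟩ := (MatrixProjection.ofMem p hp).exists_fromBlocks_equiv_of_class_eq_zero
    (congrArg Subtype.val h)
  obtain ⟨W₀, S₀, a, t, hWS₀, hWt₀, hat⟩ :=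
    hr.exists_right_inverse (MatrixProjection.ofMem p hp).isStarProjection r.isStarProjection
  obtain ⟨W, S, hWS, hWt, hS⟩ := exists_right_inverse_scalarPart_eq_one hWS₀ hWt₀
  exact ⟨r.size, W, S, a, t, hWS, hWt, hat, hS⟩

end VanishingClass

section Compression

variable {R : Type*} [Ring R] {Q : R}

/-- The compression `Q S Q` of `S` to the range of the idempotent `Q`, extended by the identity of
the range of `1 - Q`. -/
def compression (Q S : R) : R := 1 + Q * (S - 1) * Q

/-- The perturbation `S + [Q, S]` of `S`. It maps the range of the idempotent `Q` to itself and
agrees there with the compression of `S`. -/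
def commutatorPerturbation (Q S : R) : R := S + ⁅Q, S⁆

theorem mul_compression (hQ : IsIdempotentElem Q) (S : R) :
    Q * compression Q S = Q * S * Q := by
  simp only [compression, mul_add, mul_sub, sub_mul, ← mul_assoc, hQ.eq, mul_one]
  abel

theorem one_sub_mul_compression (hQ : IsIdempotentElem Q) (S : R) :
    (1 - Q) * compression Q S = 1 - Q := by
  rw [compression, mul_add, mul_one, mul_assoc Q, ← mul_assoc, hQ.one_sub_mul_self, zero_mul,
    add_zero]

theorem commutatorPerturbation_mul_self (hQ : IsIdempotentElem Q) (S : R) :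
    commutatorPerturbation Q S * Q = Q * S * Q := by
  simp only [commutatorPerturbation, Ring.lie_def, add_mul, sub_mul, mul_assoc, hQ.eq]
  abel

theorem commutatorPerturbation_mul_inverse_mul {S W : R} (hQ : IsIdempotentElem Q)
    (hW : IsUnit (W * commutatorPerturbation Q S)) (hS : IsUnit (compression Q S)) :
    commutatorPerturbation Q S * (W * commutatorPerturbation Q S)⁻¹ʳ * W * Q = Q := by
  set S' := commutatorPerturbation Q S
  have hQS : Q = S' * (Q * (compression Q S)⁻¹ʳ) := calc
    Q = Q * compression Q S * (compression Q S)⁻¹ʳ := by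
        rw [mul_assoc, Ring.mul_inverse_cancel _ hS, mul_one]
    _ = S' * (Q * (compression Q S)⁻¹ʳ) := by
        rw [mul_compression hQ, ← commutatorPerturbation_mul_self hQ, mul_assoc]
  calc S' * (W * S')⁻¹ʳ * W * Q
      = S' * ((W * S')⁻¹ʳ * (W * S')) * (Q * (compression Q S)⁻¹ʳ) := by
        conv_lhs => rw [hQS]
        simp only [mul_assoc]
    _ = Q := by rw [Ring.inverse_mul_cancel _ hW, mul_one, ← hQS]

end Compression

section Fredholm

variable {𝕜 F : Type*} [NontriviallyNormedField 𝕜] [NormedAddCommGroup F] [NormedSpace 𝕜 F]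
  [CompleteSpace F]

theorem isUnit_one_add_of_isCompactOperator {K : F →L[𝕜] F} (hK : IsCompactOperator K)
    (hinj : ∀ x, (1 + K) x = 0 → x = 0) : IsUnit (1 + K) := by
  rcases hK.hasEigenvalue_or_mem_resolventSet (neg_ne_zero.2 one_ne_zero) with h | h
  · obtain ⟨x, hx⟩ := h.exists_hasEigenvector
    have hKx : K x = (-1 : 𝕜) • x := hx.apply_eq_smul
    refine absurd (hinj x ?_) hx.2
    rw [add_apply, hKx, one_apply_eq_self, neg_one_smul, add_neg_cancel]
  · rw [spectrum.mem_resolventSet_iff, map_neg, map_one] at h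
    rw [← IsUnit.neg_iff, neg_add, ← sub_eq_add_neg]
    exact h

theorem isUnit_compression {Q S W : F →L[𝕜] F} (hQ : IsIdempotentElem Q)
    (hK : IsCompactOperator (Q * (S - 1) : F →L[𝕜] F))
    (hW : IsUnit (W * commutatorPerturbation Q S)) : IsUnit (compression Q S) := by
  refine isUnit_one_add_of_isCompactOperator (hK.comp_clm Q) fun x hx => ?_
  change compression Q S x = 0 at hx
  set S' := commutatorPerturbation Q S
  have hQx : Q x = x := by
    have := DFunLike.congr_fun (one_sub_mul_compression hQ S) x
    rw [mul_apply_eq_comp, hx, map_zero] at this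
    exact (sub_eq_zero.1 this.symm).symm
  have hSx : S' x = 0 := calc
    S' x = (S' * Q) x := congrArg S' hQx.symm
    _ = (Q * compression Q S) x := by
        rw [commutatorPerturbation_mul_self hQ, mul_compression hQ]
    _ = 0 := by rw [mul_apply_eq_comp, hx, map_zero]
  calc x = ((W * S')⁻¹ʳ * (W * S')) x := by rw [Ring.inverse_mul_cancel _ hW, one_apply_eq_self]
    _ = 0 := by simp only [mul_apply_eq_comp, hSx, map_zero]

theorem tendsto_mul_of_tendsto_lie {ι : Type*} {l : Filter ι} {Q : ι → F →L[𝕜] F}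
    {W S e : F →L[𝕜] F} (hWS : W * S = 1) (hWe : W * e = 0)
    (hQ : ∀ i, IsIdempotentElem (Q i))
    (hK : ∀ i, IsCompactOperator (Q i * (S - 1) : F →L[𝕜] F))
    (hS : Tendsto (fun i => ⁅Q i, S⁆) l (𝓝 0)) (he : Tendsto (fun i => ⁅Q i, e⁆) l (𝓝 0)) :
    Tendsto (fun i => e * Q i) l (𝓝 0) := by
  let S' i := commutatorPerturbation (Q i) S
  have hS' : Tendsto S' l (𝓝 S) := by
    simpa only [S', commutatorPerturbation, add_zero] using hS.const_add S
  have hWS' : Tendsto (fun i => W * S' i) l (𝓝 1) := by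
    simpa only [hWS] using hS'.const_mul W
  have hinv : Tendsto (fun i => (W * S' i)⁻¹ʳ) l (𝓝 1) := by
    have h1 := (NormedRing.inverse_continuousAt (1 : (F →L[𝕜] F)ˣ)).tendsto
    rw [Units.val_one, Ring.inverse_one] at h1
    exact h1.comp hWS'
  have hfix : ∀ᶠ i in l, S' i * (W * S' i)⁻¹ʳ * W * Q i = Q i := by
    filter_upwards [hWS'.eventually (Units.nhds 1)] with i hi
    exact commutatorPerturbation_mul_inverse_mul (hQ i) hi (isUnit_compression (hQ i) (hK i) hi)
  have hQe : Tendsto (fun i => Q i * e) l (𝓝 0) := by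
    refine Tendsto.congr' ?_
      (mul_zero (S * 1 * W) ▸ ((hS'.mul hinv).mul_const W).mul he)
    filter_upwards [hfix] with i hi
    rw [Ring.lie_def, mul_sub, ← mul_assoc, hi, mul_assoc _ W, ← mul_assoc W, hWe, zero_mul,
      mul_zero, sub_zero]
  simpa only [Ring.lie_def, sub_sub_cancel, sub_zero] using hQe.sub he

end Fredholm

section MatrixOperator

variable {𝕜 E n : Type*} [NontriviallyNormedField 𝕜] [NormedAddCommGroup E] [NormedSpace 𝕜 E]
  [Fintype n] [DecidableEq n]

/-- A matrix of operators on `E`, acting on column vectors over `E`. -/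
def matrixOperator : Matrix n n (E →L[𝕜] E) →+* ((n → E) →L[𝕜] (n → E)) where
  toFun M := ∑ i, ∑ j, ContinuousLinearMap.single 𝕜 (fun _ => E) i ∘L M i j ∘L
    ContinuousLinearMap.proj j
  map_zero' := by simp
  map_one' := by
    ext x i
    suffices ∑ j, (1 : Matrix n n (E →L[𝕜] E)) i j (x j) = x i by simpa [Pi.single_apply]
    rw [Fintype.sum_eq_single i fun j hj => by rw [Matrix.one_apply_ne' hj, zero_apply],
      Matrix.one_apply_eq, one_apply_eq_self]
  map_add' M N := by simp [Finset.sum_add_distrib]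
  map_mul' M N := by
    ext x i
    simpa [Matrix.mul_apply, Pi.single_apply, apply_ite] using Finset.sum_comm

theorem matrixOperator_def (M : Matrix n n (E →L[𝕜] E)) :
    matrixOperator M = ∑ i, ∑ j, ContinuousLinearMap.single 𝕜 (fun _ => E) i ∘L M i j ∘L
      ContinuousLinearMap.proj j := rfl

theorem proj_comp_matrixOperator_comp_single (M : Matrix n n (E →L[𝕜] E)) (i j : n) :
    ContinuousLinearMap.proj i ∘L matrixOperator M ∘L
      ContinuousLinearMap.single 𝕜 (fun _ => E) j = M i j := by
  ext x
  simp [matrixOperator_def, Pi.single_apply, apply_ite]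

theorem isEmbedding_matrixOperator :
    IsEmbedding (matrixOperator : Matrix n n (E →L[𝕜] E) → (n → E) →L[𝕜] (n → E)) := by
  let entries (T : (n → E) →L[𝕜] (n → E)) : Matrix n n (E →L[𝕜] E) := fun i j =>
    ContinuousLinearMap.proj i ∘L T ∘L ContinuousLinearMap.single 𝕜 (fun _ => E) j
  have hleft : Function.LeftInverse entries matrixOperator := fun M =>
    Matrix.ext (proj_comp_matrixOperator_comp_single M)
  refine hleft.isEmbedding ?_ ?_
  · exact continuous_matrix fun i j => by fun_prop
  · change Continuous fun M => matrixOperator M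
    simp only [matrixOperator_def]
    exact continuous_finsetSum _ fun i _ => continuous_finsetSum _ fun j _ => by
      have := continuous_id.matrix_elem (R := E →L[𝕜] E) i j
      fun_prop

theorem isCompactOperator_matrixOperator {M : Matrix n n (E →L[𝕜] E)}
    (hM : ∀ i j, IsCompactOperator (M i j)) : IsCompactOperator (matrixOperator M) := by
  rw [matrixOperator_def]
  refine Submodule.sum_mem (compactOperator (RingHom.id 𝕜) (n → E) (n → E)) fun i _ =>
    Submodule.sum_mem _ fun j _ => ?_
  exact ((hM i j).comp_clm (ContinuousLinearMap.proj (R := 𝕜) (φ := fun _ => E) j)).clm_comp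
    (ContinuousLinearMap.single 𝕜 (fun _ => E) i)

end MatrixOperator

section Quasidiagonal

variable {A E ι : Type*} [NonUnitalRing A] [Module ℂ A] [SMulCommClass ℂ A A]
  [IsScalarTower ℂ A A] [NormedAddCommGroup E] [NormedSpace ℂ E]

theorem unitizationLift_apply {C : Type*} [Ring C] [Algebra ℂ C] (π : A →ₙₐ[ℂ] C)
    (x : Unitization ℂ A) : Unitization.lift π x = algebraMap ℂ C x.fst + π x.snd := rfl

/-- A family of idempotents that asymptotically commute with a representation `π` and cut its range
down to compact operators. This is quasidiagonality with the finite rank of the idempotents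
relaxed to compactness of their products with the represented operators. -/
structure IsLocallyQuasidiagonal (π : A →ₙₐ[ℂ] (E →L[ℂ] E)) (l : Filter ι)
    (Q : ι → E →L[ℂ] E) : Prop where
  isIdempotentElem i : IsIdempotentElem (Q i)
  tendsto_lie a : Tendsto (fun i => ⁅Q i, π a⁆) l (𝓝 0)
  isCompactOperator_mul i a : IsCompactOperator (Q i * π a : E →L[ℂ] E)

namespace IsLocallyQuasidiagonal

variable {π : A →ₙₐ[ℂ] (E →L[ℂ] E)} {l : Filter ι} {Q : ι → E →L[ℂ] E}

theorem tendsto_lie_lift (hQ : IsLocallyQuasidiagonal π l Q) (x : Unitization ℂ A) :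
    Tendsto (fun i => ⁅Q i, Unitization.lift π x⁆) l (𝓝 0) := by
  refine (hQ.tendsto_lie x.snd).congr fun i => ?_
  rw [unitizationLift_apply, Ring.lie_def, Ring.lie_def, mul_add, add_mul, Algebra.commutes,
    add_sub_add_left_eq_sub]

variable {m n : Type*} [Fintype m] [Fintype n] [DecidableEq m] [DecidableEq n]

theorem tendsto_diagonal_mul_sub_mul_diagonal (hQ : IsLocallyQuasidiagonal π l Q)
    (M : Matrix m n (Unitization ℂ A)) :
    Tendsto (fun i => Matrix.diagonal (fun _ : m => Q i) * M.map (Unitization.lift π) -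
      M.map (Unitization.lift π) * Matrix.diagonal fun _ : n => Q i) l (𝓝 0) := by
  refine tendsto_pi_nhds.2 fun j => tendsto_pi_nhds.2 fun k => ?_
  refine (hQ.tendsto_lie_lift (M j k)).congr fun i => ?_
  rw [Matrix.sub_apply, Matrix.diagonal_mul, Matrix.mul_diagonal, Matrix.map_apply, Ring.lie_def]

theorem isCompactOperator_matrixOperator_diagonal_mul (hQ : IsLocallyQuasidiagonal π l Q) (i : ι)
    {M : Matrix n n (Unitization ℂ A)} (hM : M.map (Unitization.fstHom ℂ A) = 0) :
    IsCompactOperator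
      (matrixOperator (Matrix.diagonal (fun _ : n => Q i) * M.map (Unitization.lift π))) := by
  refine isCompactOperator_matrixOperator fun j k => ?_
  have hfst : (M j k).fst = 0 := congrFun₂ hM j k
  rw [Matrix.diagonal_mul, Matrix.map_apply, unitizationLift_apply, hfst, map_zero, zero_add]
  exact hQ.isCompactOperator_mul i _

theorem tendsto_map_mul_diagonal [CompleteSpace E] (hQ : IsLocallyQuasidiagonal π l Q)
    {W S e : Matrix n n (Unitization ℂ A)} (hWS : W * S = 1) (hWe : W * e = 0)
    (hS : S.map (Unitization.fstHom ℂ A) = 1) :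
    Tendsto (fun i => e.map (Unitization.lift π) * Matrix.diagonal fun _ : n => Q i) l (𝓝 0) := by
  let Φ : Matrix n n (Unitization ℂ A) →+* ((n → E) →L[ℂ] (n → E)) :=
    matrixOperator.comp (Unitization.lift π).mapMatrix.toRingHom
  let P i : (n → E) →L[ℂ] (n → E) := matrixOperator (Matrix.diagonal fun _ : n => Q i)
  have hP i : IsIdempotentElem (P i) := by
    refine IsIdempotentElem.map ?_ matrixOperator
    rw [IsIdempotentElem, Matrix.diagonal_mul_diagonal, (hQ.isIdempotentElem i).eq]
  have hPΦ M : Tendsto (fun i => ⁅P i, Φ M⁆) l (𝓝 0) := by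
    have := (isEmbedding_matrixOperator.continuous.tendsto 0).comp
      (hQ.tendsto_diagonal_mul_sub_mul_diagonal M)
    rw [map_zero] at this
    refine this.congr fun i => ?_
    rw [Function.comp_apply, map_sub, map_mul, map_mul]
    rfl
  have hPS i : IsCompactOperator (P i * (Φ S - 1) : (n → E) →L[ℂ] (n → E)) := by
    have hS1 : (S - 1).map (Unitization.fstHom ℂ A) = 0 := by
      rw [Matrix.map_sub _ (map_sub _), hS, Matrix.map_one _ (map_zero _) (map_one _), sub_self]
    rw [← map_one Φ, ← map_sub]
    have := hQ.isCompactOperator_matrixOperator_diagonal_mul i hS1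
    rw [map_mul] at this
    exact this
  have hlim : Tendsto (fun i => Φ e * P i) l (𝓝 0) :=
    tendsto_mul_of_tendsto_lie (by rw [← map_mul, hWS, map_one]) (by rw [← map_mul, hWe, map_zero])
      hP hPS (hPΦ S) (hPΦ e)
  rw [isEmbedding_matrixOperator.tendsto_nhds_iff, map_zero]
  exact hlim.congr fun i => (map_mul matrixOperator _ _).symm

theorem tendsto_mul_of_ofProjection_eq_zero [CompleteSpace E] [StarRing A] [StarModule ℂ A]
    (hQ : IsLocallyQuasidiagonal π l Q) {p : A} {hp : IsStarProjection p}
    (h : K0.ofProjection p hp = 0) : Tendsto (fun i => π p * Q i) l (𝓝 0) := by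
  obtain ⟨n, W, S, a, t, hWS, hWt, hat, hS⟩ := K0.exists_right_inverse_of_ofProjection_eq_zero h
  let ρ := Unitization.lift π
  let Δ (k : ℕ) (i : ι) : Matrix (Fin k) (Fin k) (E →L[ℂ] E) := Matrix.diagonal fun _ => Q i
  have hρp : (a.map ρ * (t * a).map ρ * t.map ρ) 0 0 = π p := by
    have hpp : (p : Unitization ℂ A) * p = p := by
      rw [← Unitization.inr_mul, hp.isIdempotentElem.eq]
    rw [← Matrix.map_mul, ← Matrix.map_mul, Matrix.mul_assoc, Matrix.mul_assoc, hat,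
      ← Matrix.mul_assoc, hat, Matrix.diagonal_mul_diagonal, hpp, Matrix.map_apply,
      Matrix.diagonal_apply_eq, unitizationLift_apply, Unitization.fst_inr, map_zero,
      zero_add, Unitization.snd_inr]
  have hta : Tendsto (fun i => (t * a).map ρ * Δ n i) l (𝓝 0) :=
    hQ.tendsto_map_mul_diagonal hWS (by rw [← Matrix.mul_assoc, hWt, Matrix.zero_mul]) hS
  have ht : Tendsto (fun i => Δ n i * t.map ρ - t.map ρ * Δ 1 i) l (𝓝 0) :=
    hQ.tendsto_diagonal_mul_sub_mul_diagonal t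
  let f (X : Matrix (Fin n) (Fin n) (E →L[ℂ] E)) (Y : Matrix (Fin n) (Fin 1) (E →L[ℂ] E)) :
      Matrix (Fin 1) (Fin 1) (E →L[ℂ] E) :=
    a.map ρ * X * t.map ρ - a.map ρ * (t * a).map ρ * Y
  have hf : Continuous fun X : _ × _ => f X.1 X.2 :=
    ((continuous_const.matrix_mul continuous_fst).matrix_mul continuous_const).sub
      (continuous_const.matrix_mul continuous_snd)
  have hlim := ((hf.matrix_elem 0 0).tendsto (0, 0)).comp (hta.prodMk_nhds ht)
  simp only [f, Matrix.mul_zero, Matrix.zero_mul, sub_zero, Matrix.zero_apply] at hlim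
  refine hlim.congr fun i => ?_
  rw [Function.comp_apply, Matrix.mul_sub, ← Matrix.mul_assoc, ← Matrix.mul_assoc,
    ← Matrix.mul_assoc, sub_sub_cancel, Matrix.mul_diagonal, hρp]

end IsLocallyQuasidiagonal

end Quasidiagonal

section AsymptoticCommutation

variable {R ι : Type*} [SeminormedRing R] {l : Filter ι} {Q : ι → R}

theorem isClosed_setOf_tendsto_lie (hQ : ∀ i, ‖Q i‖ ≤ 1) :
    IsClosed {T : R | Tendsto (fun i => ⁅Q i, T⁆) l (𝓝 0)} := by
  have hlip i : LipschitzWith 2 fun T : R => ⁅Q i, T⁆ := by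
    refine LipschitzWith.of_dist_le_mul fun S T => ?_
    rw [dist_eq_norm, dist_eq_norm]
    calc ‖⁅Q i, S⁆ - ⁅Q i, T⁆‖ = ‖Q i * (S - T) - (S - T) * Q i‖ := by
          congr 1; simp only [Ring.lie_def]; noncomm_ring
      _ ≤ ‖Q i‖ * ‖S - T‖ + ‖S - T‖ * ‖Q i‖ :=
          (norm_sub_le _ _).trans (add_le_add (norm_mul_le _ _) (norm_mul_le _ _))
      _ ≤ 1 * ‖S - T‖ + ‖S - T‖ * 1 := by gcongr <;> exact hQ i
      _ = (2 : NNReal) * ‖S - T‖ := by push_cast; ring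
  exact (LipschitzWith.uniformEquicontinuous _ 2 hlip).equicontinuous.isClosed_setOfPred_tendsto
    continuous_const

end AsymptoticCommutation

section Truncation

/-- The indicator function of a finite subset of a discrete space. -/
def finiteIndicator {D : Type*} [TopologicalSpace D] [DiscreteTopology D] {C : Set D}
    (hC : C.Finite) : C₀(D, ℂ) where
  toFun := C.indicator 1
  continuous_toFun := continuous_of_discreteTopology
  zero_at_infty' := by
    refine tendsto_const_nhds.congr' ?_
    filter_upwards [hC.isCompact.compl_mem_cocompact] with x hx
    exact (Set.indicator_of_notMem hx _).symm

theorem tsupport_finiteIndicator {D : Type*} [TopologicalSpace D] [DiscreteTopology D] {C : Set D}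
    (hC : C.Finite) : tsupport (finiteIndicator hC) = C := by
  rw [tsupport, closure_discrete]
  exact Set.support_indicator.trans (by rw [Pi.one_def, Function.support_const one_ne_zero,
    Set.inter_univ])

variable {D H : Type*} [TopologicalSpace D] [DiscreteTopology D] [NormedAddCommGroup H]
  [InnerProductSpace ℂ H] [CompleteSpace H] {C : Set D}

variable (H) in
/-- The projection of `ℓ²(D, H)` onto the subspace of functions supported in the finite set `C`. -/
def truncation (hC : C.Finite) : EllTwo D H →L[ℂ] EllTwo D H :=
  multiplicationRep D H (finiteIndicator hC)

theorem truncation_apply (hC : C.Finite) (ξ : EllTwo D H) (x : D) :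
    truncation H hC ξ x = C.indicator ξ x :=
  (Set.indicator_smul_apply_left C 1 ξ x).symm.trans (by simp)

theorem truncation_single_of_mem [DecidableEq D] (hC : C.Finite) {z : D} (hz : z ∈ C) (η : H) :
    truncation H hC (lp.single 2 z η) = lp.single 2 z η := by
  ext x
  rw [truncation_apply, Set.indicator_apply_eq_self]
  exact fun hx => lp.single_apply_ne _ _ _ fun h => hx (h ▸ hz)

theorem truncation_single_of_notMem [DecidableEq D] (hC : C.Finite) {z : D} (hz : z ∉ C) (η : H) :
    truncation H hC (lp.single 2 z η) = 0 := by
  ext x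
  rw [truncation_apply]
  exact Set.indicator_apply_eq_zero.2 fun hx => lp.single_apply_ne _ _ _ fun h => hz (h ▸ hx)

theorem isIdempotentElem_truncation (hC : C.Finite) : IsIdempotentElem (truncation H hC) := by
  refine .map ?_ (multiplicationRep D H)
  ext x
  change C.indicator (1 : D → ℂ) x * C.indicator 1 x = C.indicator 1 x
  rw [← Set.inter_indicator_mul, Set.inter_self]
  simp only [Pi.one_apply, mul_one]
  rfl

theorem norm_truncation_le (hC : C.Finite) : ‖truncation H hC‖ ≤ 1 := by
  refine (norm_multiplication_le _).trans ?_
  rw [← ZeroAtInftyContinuousMap.norm_toBCF_eq_norm]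
  exact (BoundedContinuousFunction.norm_le zero_le_one).2 fun x =>
    (norm_indicator_le_norm_self 1 x).trans norm_one.le

end Truncation

section RoeTruncation

variable {D H : Type*} [MetricSpace D] [DiscreteTopology D] [NormedAddCommGroup H]
  [InnerProductSpace ℂ H] [CompleteSpace H] {T : EllTwo D H →L[ℂ] EllTwo D H}

theorem HasFinitePropagation.exists_apply_single_eq_zero [DecidableEq D]
    (hT : HasFinitePropagation (multiplicationRep D H) T) :
    ∃ R : ℝ, ∀ (x w : D) (η : H), R < dist x w → T (lp.single 2 w η) x = 0 := by
  obtain ⟨R, -, hR⟩ := hT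
  refine ⟨R, fun x w η hxw => ?_⟩
  have h : truncation H (Set.finite_singleton x) * T * truncation H (Set.finite_singleton w) = 0 :=
    hR _ _ (by simpa only [tsupport_finiteIndicator, Set.mem_singleton_iff, forall_eq] using hxw)
  calc T (lp.single 2 w η) x
      = truncation H (Set.finite_singleton x)
          (T (truncation H (Set.finite_singleton w) (lp.single 2 w η))) x := by
        rw [truncation_single_of_mem _ (Set.mem_singleton w), truncation_apply,
          Set.indicator_of_mem (Set.mem_singleton x)]
    _ = 0 := congrArg (fun S : EllTwo D H →L[ℂ] EllTwo D H => S (lp.single 2 w η) x) h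

theorem HasFinitePropagation.exists_commute_truncation
    (hT : HasFinitePropagation (multiplicationRep D H) T) :
    ∃ R : ℝ, ∀ (C : Set D) (hC : C.Finite), (∀ x w, dist x w ≤ R → (x ∈ C ↔ w ∈ C)) →
      Commute (truncation H hC) T := by
  classical
  obtain ⟨R, hR⟩ := hT.exists_apply_single_eq_zero
  refine ⟨R, fun C hC hsep => lp.ext_continuousLinearMap (by simp) fun w => ?_⟩
  ext η x
  change truncation H hC (T (lp.single 2 w η)) x = T (truncation H hC (lp.single 2 w η)) x
  rw [truncation_apply]
  by_cases hxw : dist x w ≤ R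
  · by_cases hw : w ∈ C
    · rw [truncation_single_of_mem hC hw, Set.indicator_of_mem ((hsep x w hxw).2 hw)]
    · rw [truncation_single_of_notMem hC hw, Set.indicator_of_notMem (mt (hsep x w hxw).1 hw),
        map_zero]
      rfl
  · rw [Set.indicator_apply_eq_zero.2 fun _ => hR x w η (not_le.1 hxw)]
    by_cases hw : w ∈ C
    · rw [truncation_single_of_mem hC hw, hR x w η (not_le.1 hxw)]
    · rw [truncation_single_of_notMem hC hw, map_zero]
      rfl

theorem isCompactOperator_multiplicationRep_mul_of_mem_roeAlgebra (hT : T ∈ RoeAlgebra D H)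
    (f : C₀(D, ℂ)) :
    IsCompactOperator (multiplicationRep D H f * T : EllTwo D H →L[ℂ] EllTwo D H) := by
  have hclosed : IsClosed {T : EllTwo D H →L[ℂ] EllTwo D H |
      IsCompactOperator (multiplicationRep D H f * T : EllTwo D H →L[ℂ] EllTwo D H)} :=
    isClosed_setOfPred_isCompactOperator.preimage (continuous_const_mul (multiplicationRep D H f))
  exact closure_minimal (fun S hS => (hS.1 f).2) hclosed hT

theorem isLocallyQuasidiagonal_truncation {ι : Type*} {l : Filter ι} {C : ι → Set D}
    (hC : ∀ i, (C i).Finite)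
    (hsep : ∀ R : ℝ, ∀ᶠ i in l, ∀ x w, dist x w ≤ R → (x ∈ C i ↔ w ∈ C i)) :
    IsLocallyQuasidiagonal
      (NonUnitalStarSubalgebraClass.subtype (RoeAlgebra D H)).toNonUnitalAlgHom l
      fun i => truncation H (hC i) where
  isIdempotentElem i := isIdempotentElem_truncation (hC i)
  tendsto_lie T := by
    refine closure_minimal (fun S hS => ?_)
      (isClosed_setOf_tendsto_lie fun i => norm_truncation_le (hC i)) T.2
    obtain ⟨R, hR⟩ := hS.2.exists_commute_truncation
    refine tendsto_const_nhds.congr' ?_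
    filter_upwards [hsep R] with i hi
    exact (hR (C i) (hC i) hi).lie_eq.symm
  isCompactOperator_mul i T :=
    isCompactOperator_multiplicationRep_mul_of_mem_roeAlgebra T.2 (finiteIndicator (hC i))

end RoeTruncation

section Inclusion

variable {D H : Type*} [NormedAddCommGroup H] [InnerProductSpace ℂ H]

theorem isometryTensor_single [DecidableEq D] (V : ℂ →ₗᵢ[ℂ] H) (z : D) (c : ℂ) :
    isometryTensor D V (lp.single 2 z c) = lp.single 2 z (V c) := by
  ext x
  rw [isometryTensor_apply]
  obtain rfl | hx := eq_or_ne x z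
  · rw [lp.single_apply_self, lp.single_apply_self]
  · rw [lp.single_apply_ne _ _ _ hx, lp.single_apply_ne _ _ _ hx, map_zero]

theorem one_le_norm_conjugation_one_mul_truncation [CompleteSpace H] [TopologicalSpace D]
    [DiscreteTopology D] (V : ℂ →ₗᵢ[ℂ] H) {C : Set D} (hC : C.Finite) (hne : C.Nonempty) :
    1 ≤ ‖conjugation D V 1 * truncation H hC‖ := by
  classical
  obtain ⟨z, hz⟩ := hne
  let v : EllTwo D H := lp.single 2 z (V 1)
  have hv : ‖v‖ = 1 := by
    rw [lp.norm_single (by simp), V.norm_map, norm_one]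
  have hfix : (conjugation D V 1 * truncation H hC) v = v := by
    have hadj := DFunLike.congr_fun (adjoint_isometryTensor_comp V) (lp.single 2 z (1 : ℂ))
    rw [ContinuousLinearMap.comp_apply, one_apply_eq_self] at hadj
    rw [mul_apply_eq_comp, truncation_single_of_mem hC hz, ← isometryTensor_single,
      conjugation_apply, ContinuousLinearMap.comp_apply, ContinuousLinearMap.comp_apply, hadj,
      one_apply_eq_self, isometryTensor_single]
  simpa only [hfix, hv, mul_one] using (conjugation D V 1 * truncation H hC).le_opNorm v

end Inclusion

theorem mem_supp_iff_of_dist_le {D : Type*} [MetricSpace D] {α : ℝ}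
    (c : (distanceGraph D α).ConnectedComponent) {x w : D} (h : dist x w ≤ α) :
    x ∈ c.supp ↔ w ∈ c.supp := by
  obtain rfl | hne := eq_or_ne x w
  · exact Iff.rfl
  · exact c.mem_supp_congr_adj ⟨hne, h⟩

theorem lemma3p5_general {D : Type*} [MetricSpace D] [DiscreteTopology D]
    {H : Type*} [NormedAddCommGroup H] [InnerProductSpace ℂ H] [CompleteSpace H]
    (V : ℂ →ₗᵢ[ℂ] H)
    (hfin : ∀ α : ℝ, 0 < α →
      ∃ c : (distanceGraph D α).ConnectedComponent, c.supp.Finite) :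
    K0.map (roeInclusion D V)
      (K0.ofProjection (uniformRoeUnit D) (isStarProjection_uniformRoeUnit D)) ≠ 0 := by
  intro h
  rw [K0.map_ofProjection] at h
  choose c hc using fun n : ℕ => hfin (n + 1) (by positivity)
  have hsep (R : ℝ) : ∀ᶠ n in atTop, ∀ x w, dist x w ≤ R → (x ∈ (c n).supp ↔ w ∈ (c n).supp) := by
    filter_upwards [eventually_ge_atTop ⌈R⌉₊] with n hn x w hxw
    exact mem_supp_iff_of_dist_le (c n)
      (hxw.trans ((Nat.ceil_le.1 hn).trans (le_add_of_nonneg_right zero_le_one)))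
  have hlim := (isLocallyQuasidiagonal_truncation hc hsep).tendsto_mul_of_ofProjection_eq_zero h
  have hle : (1 : ℝ) ≤ ‖(0 : EllTwo D H →L[ℂ] EllTwo D H)‖ :=
    ge_of_tendsto' hlim.norm fun n =>
      one_le_norm_conjugation_one_mul_truncation V (hc n) (c n).nonempty_supp
  rw [norm_zero] at hle
  exact not_lt_of_ge hle one_pos

end

theorem lemma3p5 {D : Type*} [MetricSpace D] [UniformlyDiscrete D] (hD : BoundedGeometry D)
    {H : Type*} [NormedAddCommGroup H] [InnerProductSpace ℂ H] [CompleteSpace H]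
    (V : ℂ →ₗᵢ[ℂ] H)
    (hfin : ∀ α : ℝ, 0 < α →
      ∃ c : (distanceGraph D α).ConnectedComponent, c.supp.Finite) :
    K0.map (roeInclusion D V)
      (K0.ofProjection (uniformRoeUnit D) (isStarProjection_uniformRoeUnit D)) ≠ 0 :=
  lemma3p5_general V hfin
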